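/- Let $\mathcal A$ be a real or complex Banach algebra with identity. For a ring $R$ with identity, call $x\in R$ quasinilpotent if $1+xy$ is invertible for every $y\in R$ with $xy=yx$ (in a Banach algebra this means $\lim_{n\to\infty}\|x^n\|^{1/n}=0$). An element $a\in R$ is g-Drazin invertible if there is $a^d\in R$ (necessarily unique, called the g-Drazin inverse of $a$) with $a^d=a^daa^d$, $aa^d=a^da$ and $a-a^2a^d$ quasinilpotent; then $a^\pi:=1-aa^d$. Matrices below are elements of the ring $M_2(\mathcal A)$. **Theorem 2.2.** Let $a,b\in\mathcal A$ be such that $a$, $b$ and $b^\pi a$ are g-Drazin invertible, and suppose $b^\pi ab^d=0$. Then the following are equivalent: 1. $M=\begin{pmatrix}a&1\\ b&0\end{pmatrix}$ is g-Drazin invertible; 2. $N=\begin{pmatrix}b^\pi a&1\\ b^\pi b&0\end{pmatrix}$ is g-Drazin invertible; 3. $\begin{pmatrix}ab^\pi&1\\ bb^\pi&0\end{pmatrix}$ is g-Drazin invertible. Moreover, suppose $N$ is g-Drazin invertible, and put $$\alpha=\begin{pmatrix}bb^dabb^d&bb^d\\ b^2b^d&0\end{pmatrix},\qquad S=\begin{pmatrix}bb^dab^\pi+b^\pi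 a&b^\pi\\ bb^\pi&0\end{pmatrix}.$$ Then $\alpha$ has the group inverse (that is, $\alpha\alpha^\#\alpha=\alpha$, $\alpha^\#\alpha\alpha^\#=\alpha^\#$, $\alpha\alpha^\#=\alpha^\#\alpha$) $$\alpha^\#=\begin{pmatrix}0&b^d\\ bb^d&-bb^dab^d\end{pmatrix},\qquad \alpha^\pi:=1-\alpha\alpha^\#=\begin{pmatrix}b^\pi&0\\ 0&b^\pi\end{pmatrix};$$ $S$ is g-Drazin invertible with $$S^d=\begin{pmatrix}bb^da+b^\pi a&1\\ b&0\end{pmatrix}N^d\begin{pmatrix}1&0\\ 0&b^\pi\end{pmatrix}N^d\begin{pmatrix}b^\pi&0\\ 0&b^\pi\end{pmatrix};$$ and $$M^d=\alpha^\pi S^d+\sum_{i=0}^{\infty}(\alpha^\#)^{i+1}S^iS^\pi,$$ where the series converges unconditionally in $M_2(\mathcal A)$ (with the product topology of $\mathcal A^4$). -/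

import Mathlib

/-- An element `a` of a ring (with identity) is quasinilpotent if `1 + a x` is invertible for every
`x` commuting with `a`. -/
def GDQuasinilpotent {R : Type*} [Ring R] (a : R) : Prop :=
  ∀ x : R, a * x = x * a → IsUnit (1 + a * x)

/-- `c` is the g-Drazin inverse `a^d` of `a`: `c = c a c`, `a c = c a` and `a - a² c` is
quasinilpotent. -/
structure IsGDrazinInverse {R : Type*} [Ring R] (a c : R) : Prop where
  outer : c = c * a * c
  comm : a * c = c * a
  quasinilpotent : GDQuasinilpotent (a - a ^ 2 * c)

/-- `a` is g-Drazin invertible, that is `a ∈ R^d`. -/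
def GDrazinInvertible {R : Type*} [Ring R] (a : R) : Prop :=
  ∃ c : R, IsGDrazinInverse a c

/-- The spectral idempotent `a^π = 1 - a a^d`, where `ad` is the g-Drazin inverse of `a`. -/
def spectralIdem {R : Type*} [Ring R] (a ad : R) : R := 1 - a * ad

/-- `c` is the group inverse `a^#` of `a`. -/
structure IsGroupInverse {R : Type*} [Ring R] (a c : R) : Prop where
  inner : a * c * a = a
  outer : c * a * c = c
  comm : a * c = c * a

/-! Let `P` be the diagonal matrix with both entries `b^π`. The hypothesis `b^π a b^d = 0` says
exactly that `P * M * (1 - P) = 0`, so `M` is block triangular. Then `M = α + S` with `α = M * (1 -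
P)`, `S = M * P` and `S * α = 0`, and `α'` inverts `α` in the corner of `1 - P`. If `S` is g-Drazin
invertible, so is `M`, with the stated series (`IsGDrazinInverse.add_of_mul_eq_zero`). Conversely,
the block of `M` in the corner of `P` inherits invertibility because the other block is invertible
(`IsGDrazinInverse.corner`). With `Q = diag(1, b^π)`, the identities `S = M * P`, `P * M = N * Q`,
`Q * N = N`, `S = K * Q`, `Q * K = K` let Cline's formula pass between `S`, `N` and the third matrix
`K`, and compute `S^d` from `N^d`. All of this needs the analytic meaning of quasinilpotency:
`GDQuasinilpotent` implies `PowSmall` (Rickart's averaging, valid over the reals), and `PowSmall`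
implies `GDQuasinilpotent`. -/

open Filter Topology

/-! ### Rickart's averaging argument. -/

/-- The powers of `x` decay faster than every geometric sequence, that is
`‖x ^ n‖ ^ (1 / n) → 0`. -/
def PowSmall {B : Type*} [NormedRing B] (x : B) : Prop :=
  ∀ r : ℝ, 0 < r → ∃ C : ℝ, ∀ n : ℕ, ‖x ^ n‖ ≤ C * r ^ n

/-- The average of the resolvent `z ↦ (1 - φ z * x)⁻¹` over the points `r * ζ ^ j`. -/
noncomputable def resolventAverage {C : Type*} [Ring C] [Algebra ℝ C] (φ : ℂ →ₐ[ℝ] C) (x : C)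
    (n : ℕ) (ζ : ℂ) (r : ℝ) : C :=
  (n : ℝ)⁻¹ • ∑ j ∈ Finset.range n, Ring.inverse (1 - φ (ζ ^ j * r) * x)

/-- Each `1 - r ^ n • x ^ n` is a geometric sum times `1 - φ (ζ ^ j * r) * x`; averaging the
geometric sums over the roots of unity leaves only the constant term. -/
theorem one_sub_smul_pow_mul_resolventAverage {C : Type*} [Ring C] [Algebra ℝ C]
    (φ : ℂ →ₐ[ℝ] C) {x : C} (hc : ∀ z, Commute (φ z) x)
    (hu : ∀ z, IsUnit (1 - φ z * x)) {n : ℕ} (hn : 0 < n) {ζ : ℂ} (hζ : IsPrimitiveRoot ζ n)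
    (r : ℝ) :
    (1 - r ^ n • x ^ n) * resolventAverage φ x n ζ r = 1 := by
  have hφr : ∀ t : ℝ, φ (t : ℂ) = algebraMap ℝ C t := fun t => φ.commutes t
  have key : ∀ j, (1 - r ^ n • x ^ n) * Ring.inverse (1 - φ (ζ ^ j * r) * x)
      = ∑ k ∈ Finset.range n, φ ((ζ ^ k) ^ j) * (r ^ k • x ^ k) := by
    intro j
    have hpow : ∀ k, (φ (ζ ^ j * r) * x) ^ k = φ ((ζ ^ k) ^ j) * (r ^ k • x ^ k) := by
      intro k
      rw [(hc _).mul_pow, ← map_pow, mul_pow, map_mul, ← Complex.ofReal_pow, hφr,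
        mul_assoc, ← Algebra.smul_def, ← pow_mul, ← pow_mul, mul_comm]
    have h1 : r ^ n • x ^ n = (φ (ζ ^ j * r) * x) ^ n := by
      rw [hpow, hζ.pow_eq_one, one_pow, map_one, one_mul]
    rw [h1, ← geom_sum_mul_neg, mul_assoc, Ring.mul_inverse_cancel _ (hu _), mul_one]
    exact Finset.sum_congr rfl fun k _ => hpow k
  have hsum : ∑ j ∈ Finset.range n, ∑ k ∈ Finset.range n, φ ((ζ ^ k) ^ j) * (r ^ k • x ^ k)
      = (n : C) := by
    rw [Finset.sum_comm]
    simp_rw [← Finset.sum_mul, ← map_sum]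
    rw [Finset.sum_eq_single_of_mem 0 (Finset.mem_range.2 hn)]
    · simp
    · intro k hk hk0
      have h1 : ζ ^ k ≠ 1 := hζ.pow_ne_one_of_pos_of_lt hk0 (Finset.mem_range.1 hk)
      have h2 : (1 - ζ ^ k) * ∑ i ∈ Finset.range n, (ζ ^ k) ^ i = 0 := by
        rw [mul_neg_geom_sum, ← pow_mul, mul_comm, pow_mul, hζ.pow_eq_one, one_pow, sub_self]
      rw [(mul_eq_zero.1 h2).resolve_left (sub_ne_zero.2 h1.symm), map_zero, zero_mul]
  rw [resolventAverage, mul_smul_comm, Finset.mul_sum, Finset.sum_congr rfl fun j _ => key j, hsum,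
    ← map_natCast (algebraMap ℝ C), Algebra.algebraMap_eq_smul_one, smul_smul,
    inv_mul_cancel₀ (Nat.cast_ne_zero.2 hn.ne'), one_smul]

/-- The resolvent is uniformly continuous on a closed disc. Since `ζ` has modulus 1, a single `δ`
serves every `n`. -/
theorem exists_resolventAverage_sub_le {C : Type*} [NormedRing C] [NormedAlgebra ℝ C]
    [CompleteSpace C] (φ : ℂ →ₐ[ℝ] C) {x : C} (hu : ∀ z, IsUnit (1 - φ z * x)) (L : ℝ) :
    ∃ δ > 0, ∀ (n : ℕ) (ζ : ℂ), IsPrimitiveRoot ζ n → ∀ r s : ℝ, |r| ≤ L → |s| ≤ L →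
      |r - s| < δ → ‖resolventAverage φ x n ζ r - resolventAverage φ x n ζ s‖ ≤ 1 / 4 := by
  have hφ : Continuous φ := φ.toLinearMap.continuous_of_finiteDimensional
  have hG : Continuous fun z => Ring.inverse (1 - φ z * x) := by
    rw [continuous_iff_continuousAt]
    intro z
    obtain ⟨u, h⟩ := hu z
    have h1 : ContinuousAt Ring.inverse (1 - φ z * x) := h ▸ NormedRing.inverse_continuousAt u
    exact ContinuousAt.comp (f := fun z => 1 - φ z * x) h1 (by fun_prop)
  have hUC := (isCompact_closedBall (0 : ℂ) L).uniformContinuousOn_of_continuous hG.continuousOn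
  obtain ⟨δ, hδ, h⟩ := Metric.uniformContinuousOn_iff.1 hUC (1 / 4) (by norm_num)
  refine ⟨δ, hδ, fun n ζ hζ r s hr hs hrs => ?_⟩
  rcases Nat.eq_zero_or_pos n with rfl | hn
  · simp [resolventAverage]
  have hn' : (0 : ℝ) < n := by exact_mod_cast hn
  have hζ1 : ‖ζ‖ = 1 := hζ.norm'_eq_one hn.ne'
  rw [resolventAverage, resolventAverage, ← smul_sub, ← Finset.sum_sub_distrib, norm_smul,
    norm_inv, Real.norm_natCast, inv_mul_le_iff₀ hn']
  refine (norm_sum_le_of_le _ (f := _) (n := fun _ => 1 / 4) fun j _ => ?_).trans (by simp)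
  rw [← dist_eq_norm]
  refine (h _ ?_ _ ?_ ?_).le
  · simpa [hζ1] using hr
  · simpa [hζ1] using hs
  · rw [dist_eq_norm, ← mul_sub, norm_mul, norm_pow, hζ1, one_pow, one_mul, ← Complex.ofReal_sub,
      Complex.norm_real]
    exact hrs

theorem norm_sub_one_le_of_one_sub_mul_eq_one {C : Type*} [NormedRing C] {w u : C}
    (h : (1 - w) * u = 1) (hw : ‖w‖ ≤ 1 / 5) : ‖u - 1‖ ≤ 1 / 4 := by
  have h1 : u - 1 = w * (u - 1) + w := by
    have : u - w * u = 1 := by rw [← h]; noncomm_ring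
    rw [mul_sub, mul_one, sub_add_cancel, sub_eq_iff_eq_add, ← sub_eq_iff_eq_add']; exact this
  have h2 : ‖u - 1‖ ≤ ‖w‖ * ‖u - 1‖ + ‖w‖ := by
    conv_lhs => rw [h1]
    exact (norm_add_le _ _).trans (by gcongr; exact norm_mul_le _ _)
  nlinarith [norm_nonneg (u - 1)]

theorem norm_le_of_one_sub_mul_eq_one {C : Type*} [NormedRing C] {w u : C}
    (h : (1 - w) * u = 1) (hu : ‖u - 1‖ ≤ 1 / 2) : ‖w‖ ≤ ‖(1 : C)‖ := by
  have h1 : w = (1 - w) * (u - 1) := by rw [mul_sub, h, mul_one, sub_sub_cancel]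
  have h2 : ‖w‖ ≤ (‖(1 : C)‖ + ‖w‖) * (1 / 2) := by
    conv_lhs => rw [h1]
    refine (norm_mul_le _ _).trans ?_
    gcongr
    exact norm_sub_le _ _
  linarith

/-- The averaging argument of Rickart for the spectral radius formula, for an element whose
resolvent is defined on all of `ℂ`. -/
theorem powSmall_of_isUnit_resolvent {C : Type*} [NormedRing C] [NormedAlgebra ℝ C]
    [CompleteSpace C] (φ : ℂ →ₐ[ℝ] C) {x : C} (hc : ∀ z, Commute (φ z) x)
    (hu : ∀ z, IsUnit (1 - φ z * x)) : PowSmall x := by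
  have step : ∀ L : ℝ, 0 < L → Tendsto (fun n => ‖L ^ n • x ^ n‖) atTop (𝓝 0) := by
    intro L hL
    -- The largest radius compared below is `(K + 1) * L / K`, hence the disc of radius `2 * L`.
    obtain ⟨δ, hδ, H⟩ := exists_resolventAverage_sub_le φ hu (2 * L)
    obtain ⟨K, hK⟩ := exists_nat_gt (max 2 (2 * L / δ))
    have hK2 : (2 : ℝ) < K := (le_max_left _ _).trans_lt hK
    have hKδ : 2 * L / δ < K := (le_max_right _ _).trans_lt hK
    have hK0 : (0 : ℝ) < K := by linarith
    have ind : ∀ k : ℕ, k ≤ K →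
        Tendsto (fun n => ‖(k * L / K : ℝ) ^ n • x ^ n‖) atTop (𝓝 0) := by
      intro k
      induction k with
      | zero =>
        intro _
        refine tendsto_const_nhds.congr' ?_
        filter_upwards [eventually_gt_atTop 0] with n hn
        simp [hn.ne']
      | succ k ih =>
        intro hk
        have hk' : (k : ℝ) + 1 ≤ K := by exact_mod_cast hk
        have h0 : (0 : ℝ) ≤ k := Nat.cast_nonneg k
        set r : ℝ := k * L / K with hr
        -- `R` lies two grid steps beyond `r`, and `2 * L / K < δ`. Mere boundedness at `R` then
        -- gives convergence to 0 one grid step lower.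
        set R : ℝ := (k + 2) * L / K with hR
        have hr0 : 0 ≤ r := by positivity
        have hR0 : 0 < R := by positivity
        have hRL : R ≤ 2 * L := by
          rw [hR, div_le_iff₀ hK0]; nlinarith
        have hrR : R - r = 2 * L / K := by rw [hR, hr]; ring
        have hrR' : 0 < 2 * L / K := by positivity
        have hd : |r - R| < δ := by
          rw [abs_sub_comm, hrR, abs_of_pos hrR', div_lt_iff₀ hK0]
          rw [div_lt_iff₀ hδ] at hKδ; linarith
        have hb : ∀ᶠ n in atTop, ‖R ^ n • x ^ n‖ ≤ ‖(1 : C)‖ := by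
          filter_upwards [eventually_gt_atTop 0,
            (ih (by omega)).eventually_le_const (show (0 : ℝ) < 1 / 5 by norm_num)] with n hn hsm
          have hζ := Complex.isPrimitiveRoot_exp n hn.ne'
          have e1 := one_sub_smul_pow_mul_resolventAverage φ hc hu hn hζ r
          have e2 := one_sub_smul_pow_mul_resolventAverage φ hc hu hn hζ R
          have b1 := norm_sub_one_le_of_one_sub_mul_eq_one e1 hsm
          have b2 := H n _ hζ r R (by rw [abs_of_nonneg hr0]; linarith)
            (by rw [abs_of_pos hR0]; exact hRL) hd
          -- The average at `R` is within 1/4 of the one at `r`, itself within 1/4 of 1.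
          refine norm_le_of_one_sub_mul_eq_one e2 ?_
          rw [norm_sub_rev] at b2
          have := norm_sub_le_norm_sub_add_norm_sub
            (resolventAverage φ x n (Complex.exp (2 * Real.pi * Complex.I / n)) R)
            (resolventAverage φ x n (Complex.exp (2 * Real.pi * Complex.I / n)) r) 1
          linarith
        have hq0 : 0 ≤ ((k : ℝ) + 1) / (k + 2) := by positivity
        have hq1 : ((k : ℝ) + 1) / (k + 2) < 1 := by rw [div_lt_one (by positivity)]; linarith
        refine squeeze_zero' (.of_forall fun n => norm_nonneg _) ?_
          (by simpa using (tendsto_pow_atTop_nhds_zero_of_lt_one hq0 hq1).mul_const ‖(1 : C)‖)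
        filter_upwards [hb] with n hn
        have : ((k + 1 : ℕ) * L / K : ℝ) = (k + 1) / (k + 2) * R := by
          rw [hR]; push_cast; field_simp
        rw [this, mul_pow, mul_smul, norm_smul, Real.norm_of_nonneg (by positivity)]
        gcongr
    have := ind K le_rfl
    rwa [mul_div_cancel_left₀ _ hK0.ne'] at this
  intro r hr
  obtain ⟨c, hc⟩ := (step r⁻¹ (inv_pos.2 hr)).bddAbove_range
  refine ⟨c, fun n => ?_⟩
  have := hc ⟨n, rfl⟩
  simp only [norm_smul, norm_pow, norm_inv, Real.norm_of_nonneg hr.le, inv_pow] at this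
  rwa [inv_mul_le_iff₀ (by positivity), mul_comm] at this

/-! ### Quasinilpotent elements of real Banach algebras have small powers. -/

section

attribute [local instance] Matrix.linftyOpNormedRing Matrix.linftyOpNormedAlgebra

theorem Matrix.completeSpace_linftyOp {n A : Type*} [Fintype n] [DecidableEq n] [NormedRing A]
    [CompleteSpace A] : @CompleteSpace (Matrix n n A)
      Matrix.linftyOpNormedRing.toPseudoMetricSpace.toUniformSpace :=
  inferInstanceAs (@CompleteSpace (Matrix n n A) (Matrix.instUniformSpace _ _ _))

/-- A square root `J` of `-1` commuting with `x` is found in the 2 × 2 matrices over `B`, which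
supplies the complex resolvent. -/
theorem GDQuasinilpotent.powSmall {B : Type*} [NormedRing B] [NormedAlgebra ℝ B]
    [CompleteSpace B] {x : B} (hx : GDQuasinilpotent x) : PowSmall x := by
  let J : Matrix (Fin 2) (Fin 2) B := !![0, -1; 1, 0]
  have hJ : J * J = -1 := by
    ext i j; fin_cases i <;> fin_cases j <;> simp [J, Matrix.mul_apply, Fin.sum_univ_two]
  let φ : ℂ →ₐ[ℝ] Matrix (Fin 2) (Fin 2) B := Complex.liftAux J hJ
  let ι : B →+* Matrix (Fin 2) (Fin 2) B := Matrix.scalar (Fin 2)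
  have hJc : ∀ y, Commute J (ι y) := by
    intro y
    ext i j; fin_cases i <;> fin_cases j <;>
      simp [J, ι, Matrix.mul_apply, Fin.sum_univ_two]
  have hφ : ∀ z, φ z = algebraMap ℝ _ z.re + z.im • J := fun z => rfl
  have hc : ∀ z, Commute (φ z) (ι x) := fun z => by
    rw [hφ]; exact Commute.add_left (Algebra.commutes _ _) ((hJc x).smul_left _)
  have hι : ∀ (t : ℝ) (y : B), ι (t • y) = t • ι y := by
    intro t y
    ext i j; fin_cases i <;> fin_cases j <;> simp [ι]
  have hu : ∀ z, IsUnit (1 - φ z * ι x) := by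
    intro z
    have hcomm : Commute (1 - φ z * ι x) (1 - φ (star z) * ι x) := by
      have : Commute (φ z * ι x) (φ (star z) * ι x) :=
        Commute.mul_left (Commute.mul_right ((Commute.all z (star z)).map φ) (hc z))
          (Commute.mul_right (hc _).symm (Commute.refl _))
      exact ((Commute.one_left _).sub_left (Commute.sub_right (Commute.one_right _) this))
    -- Multiplying by the conjugate factor gives a real quadratic in `x`, to which the
    -- quasinilpotency hypothesis applies.
    have hprod : (1 - φ z * ι x) * (1 - φ (star z) * ι x)
        = ι (1 + x * ((-(2 * z.re)) • 1 + (Complex.normSq z) • x)) := by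
      have h1 : φ z * ι x * (φ (star z) * ι x) = Complex.normSq z • (ι x * ι x) := by
        rw [mul_assoc, ← mul_assoc (ι x), ← (hc (star z)).eq, mul_assoc, ← mul_assoc (φ z),
          ← map_mul, show z * star z = (Complex.normSq z : ℂ) from Complex.mul_conj z,
          Algebra.smul_def]
        congr 1
        exact φ.commutes _
      have h2 : φ z * ι x + φ (star z) * ι x = (2 * z.re) • ι x := by
        rw [← add_mul, ← map_add, show z + star z = ((2 * z.re : ℝ) : ℂ) from Complex.add_conj z,
          Algebra.smul_def]
        congr 1
        exact φ.commutes _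
      rw [map_add, map_one, map_mul, map_add, hι, hι, map_one, mul_add, mul_smul_comm,
        mul_smul_comm, mul_one, ← h1, neg_smul, ← h2]
      noncomm_ring
    have hxu : IsUnit (1 + x * ((-(2 * z.re)) • 1 + (Complex.normSq z) • x)) := by
      apply hx
      rw [mul_add, add_mul, mul_smul_comm, mul_smul_comm, smul_mul_assoc, smul_mul_assoc, mul_one,
        one_mul]
    exact (hcomm.isUnit_mul_iff.1 (hprod ▸ hxu.map ι)).1
  have := Matrix.completeSpace_linftyOp (n := Fin 2) (A := B)
  have hC : PowSmall (ι x) := powSmall_of_isUnit_resolvent φ hc hu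
  intro r hr
  obtain ⟨c, h⟩ := hC r hr
  refine ⟨c, fun n => (le_trans ?_ (h n))⟩
  rw [← map_pow]
  have : ‖(x ^ n)‖₊ ≤ ‖ι (x ^ n)‖₊ := by
    rw [Matrix.linfty_opNNNorm_def]
    refine le_trans ?_ (Finset.le_sup (Finset.mem_univ 0))
    simp [ι, Fin.sum_univ_two]
  exact_mod_cast this

end

/-! ### Consequences of small powers. -/

theorem PowSmall.exists_norm_pow_mul_le {B : Type*} [NormedRing B] {x : B} (hx : PowSmall x)
    (y : B) {r : ℝ} (hr : 0 < r) : ∃ C : ℝ, ∀ n : ℕ, ‖x ^ n‖ * ‖y ^ n‖ ≤ C * r ^ n := by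
  obtain ⟨c, h⟩ := hx (r / (‖y‖ + 1)) (by positivity)
  have hc : 0 ≤ c := by simpa using (norm_nonneg _).trans (h 0)
  refine ⟨c * max 1 ‖(1 : B)‖, fun n => ?_⟩
  have hy : ‖y ^ n‖ ≤ max 1 ‖(1 : B)‖ * (‖y‖ + 1) ^ n := by
    rcases Nat.eq_zero_or_pos n with rfl | hn
    · simp
    · calc ‖y ^ n‖ ≤ ‖y‖ ^ n := norm_pow_le' _ hn
        _ ≤ 1 * (‖y‖ + 1) ^ n := by rw [one_mul]; gcongr; linarith
        _ ≤ _ := by gcongr; exact le_max_left _ _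
  calc ‖x ^ n‖ * ‖y ^ n‖
      ≤ (c * (r / (‖y‖ + 1)) ^ n) * (max 1 ‖(1 : B)‖ * (‖y‖ + 1) ^ n) := by
        gcongr; exact h n
    _ = c * max 1 ‖(1 : B)‖ * r ^ n := by
        rw [div_pow]; field_simp

/-- Some power of `-(x * y)` has norm below 1, so `1 - (-(x * y)) ^ n` is a unit, and `1 + x * y` is
one of its commuting factors. -/
theorem PowSmall.gdQuasinilpotent {B : Type*} [NormedRing B] [CompleteSpace B] {x : B}
    (hx : PowSmall x) : GDQuasinilpotent x := by
  intro y hxy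
  obtain ⟨c, h⟩ := hx.exists_norm_pow_mul_le y (show (0 : ℝ) < 1 / 2 by norm_num)
  have hlim : Tendsto (fun n : ℕ => c * (1 / 2 : ℝ) ^ n) atTop (𝓝 0) := by
    simpa using (tendsto_pow_atTop_nhds_zero_of_lt_one (by norm_num : (0 : ℝ) ≤ 1 / 2)
      (by norm_num)).const_mul c
  obtain ⟨n, hn⟩ := (hlim.eventually_lt_const one_pos).exists
  have hsmall : ‖(-(x * y)) ^ n‖ < 1 := by
    have e : ‖(-(x * y)) ^ n‖ = ‖(x * y) ^ n‖ := by
      rw [neg_pow]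
      rcases neg_one_pow_eq_or B n with h | h <;> simp [h]
    rw [e, Commute.mul_pow hxy]
    exact (norm_mul_le _ _).trans_lt ((h n).trans_lt hn)
  have h1 : IsUnit (1 - (-(x * y)) ^ n) := isUnit_one_sub_of_norm_lt_one hsmall
  rw [← mul_neg_geom_sum] at h1
  have hcomm : Commute (1 - -(x * y)) (∑ i ∈ Finset.range n, (-(x * y)) ^ i) :=
    (mul_neg_geom_sum _ n).trans (geom_sum_mul_neg _ n).symm
  simpa using (hcomm.isUnit_mul_iff.1 h1).1

theorem PowSmall.of_norm_pow_succ_le {B : Type*} [NormedRing B] {x y : B} (hx : PowSmall x)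
    (c : ℝ) (h : ∀ n, ‖y ^ (n + 1)‖ ≤ c * ‖x ^ n‖) : PowSmall y := by
  intro r hr
  obtain ⟨C, hC⟩ := hx r hr
  refine ⟨max ‖(1 : B)‖ (|c| * C / r), fun n => ?_⟩
  cases n with
  | zero => simp
  | succ n =>
    calc ‖y ^ (n + 1)‖ ≤ c * ‖x ^ n‖ := h n
      _ ≤ |c| * (C * r ^ n) :=
        mul_le_mul (le_abs_self c) (hC n) (norm_nonneg _) (abs_nonneg c)
      _ = |c| * C / r * r ^ (n + 1) := by field_simp; ring
      _ ≤ _ := by gcongr; exact le_max_right _ _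

/-! ### Cline's formula, sums with `S * α = 0`, and corners. -/

theorem HasSum.of_eq {ι B : Type*} [AddCommMonoid B] [TopologicalSpace B] {f g : ι → B} {a : B}
    (h : HasSum f a) (e : ∀ i, g i = f i) : HasSum g a :=
  funext e ▸ h

/-- Cline's formula, in a real Banach algebra. -/
theorem IsGDrazinInverse.cline {B : Type*} [NormedRing B] [NormedAlgebra ℝ B] [CompleteSpace B]
    {x y c : B} (h : IsGDrazinInverse (x * y) c) :
    IsGDrazinInverse (y * x) (y * c ^ 2 * x) := by
  have ho : c * (x * y) * c = c := h.outer.symm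
  have hc := h.comm
  have e1 : x * y * c * c = c := by rw [hc, ho]
  refine ⟨?_, ?_, ?_⟩
  · have : y * c ^ 2 * x * (y * x) * (y * c ^ 2 * x) = y * (c * (c * (x * y)) * (x * y * c * c)) * x := by
      noncomm_ring
    rw [this, e1, mul_assoc c, ho, pow_two]
  · have l : y * x * (y * c ^ 2 * x) = y * (x * y * c * c) * x := by noncomm_ring
    have r : y * c ^ 2 * x * (y * x) = y * (c * (c * (x * y))) * x := by noncomm_ring
    have e2 : c * (c * (x * y)) = c := by rw [← hc, ← mul_assoc, ho]
    rw [l, r, e1, e2]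
  · have e2 : y * x - (y * x) ^ 2 * (y * c ^ 2 * x) = y * ((1 - x * y * c) * x) := by
      have : (y * x) ^ 2 * (y * c ^ 2 * x) = y * (x * y * (x * y * c * c)) * x := by noncomm_ring
      rw [this, e1]; noncomm_ring
    have e3 : (1 - x * y * c) * x * y = x * y - (x * y) ^ 2 * c := by
      have : x * y * c * (x * y) = (x * y) ^ 2 * c := by
        rw [mul_assoc, ← hc, pow_two, mul_assoc (x * y)]
      rw [mul_assoc, sub_mul, one_mul, this]
    rw [e2]
    apply PowSmall.gdQuasinilpotent
    have hq := h.quasinilpotent.powSmall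
    rw [← e3] at hq
    -- The quasinilpotent part of `y * x` is `y * z`, that of `x * y` is `z * y`.
    set z := (1 - x * y * c) * x
    have hp : ∀ n, (y * z) ^ (n + 1) = y * (z * y) ^ n * z := by
      intro n
      induction n with
      | zero => simp
      | succ n ih => rw [pow_succ, ih, pow_succ]; noncomm_ring
    exact PowSmall.of_norm_pow_succ_le hq (‖y‖ * ‖z‖) fun n => by
      rw [hp]
      calc _ ≤ ‖y‖ * ‖(z * y) ^ n‖ * ‖z‖ := by
            refine (norm_mul_le _ _).trans ?_
            gcongr
            exact norm_mul_le _ _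
        _ = _ := by ring

/-- If `S * α = 0` and `α` has a group inverse, the g-Drazin inverse of `α + S` is given by a
series. -/
theorem IsGDrazinInverse.add_of_mul_eq_zero {B : Type*} [NormedRing B] [NormedAlgebra ℝ B]
    [CompleteSpace B] {α α' S s : B} (hα : IsGroupInverse α α') (hS : IsGDrazinInverse S s)
    (h0 : S * α = 0) :
    ∃ T : B, HasSum (fun i : ℕ => α' ^ (i + 1) * S ^ i * spectralIdem S s) T ∧
      IsGDrazinInverse (α + S) (spectralIdem α α' * s + T) := by
  set w := spectralIdem S s with hw
  have hw' : w = 1 - S * s := rfl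
  have sw : s * w = 0 := by rw [hw', mul_sub, mul_one, ← mul_assoc, ← hS.outer, sub_self]
  have ws : w * s = 0 := by rw [hw', sub_mul, one_mul, hS.comm, ← hS.outer, sub_self]
  have Sw : S * w = w * S := by
    rw [hw', mul_sub, sub_mul, mul_one, one_mul, mul_assoc, ← hS.comm]
  have ww : w * w = w := by
    nth_rw 1 [hw']
    rw [sub_mul, one_mul, mul_assoc, sw, mul_zero, sub_zero]
  have hq : PowSmall (S * w) := by
    have := hS.quasinilpotent.powSmall
    rwa [show S - S ^ 2 * s = S * w by rw [hw']; noncomm_ring] at this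
  -- On the range of `w`, `S` acts as its quasinilpotent part, so the powers of `S` beat those of
  -- `α'` and the series converges.
  have hSw : ∀ i, S ^ i * w = (S * w) ^ i * w := by
    intro i
    induction i with
    | zero => simp
    | succ i ih =>
      have hc : Commute w ((S * w) ^ i) :=
        Commute.pow_right (Commute.mul_right Sw.symm (Commute.refl w)) i
      calc S ^ (i + 1) * w = S * (S ^ i * w) := by rw [pow_succ', mul_assoc]
        _ = S * ((S * w) ^ i * (w * w)) := by rw [ih, ww]
        _ = S * w * (S * w) ^ i * w := by
          rw [← mul_assoc _ w w, ← hc.eq]; simp only [mul_assoc]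
        _ = _ := by rw [← pow_succ']
  have hsum : Summable fun i : ℕ => α' ^ (i + 1) * S ^ i * w := by
    obtain ⟨C, hC⟩ := hq.exists_norm_pow_mul_le α' (show (0 : ℝ) < 1 / 2 by norm_num)
    refine Summable.of_norm_bounded (g := fun i => ‖α'‖ * (C * (1 / 2) ^ i) * ‖w‖)
      (((summable_geometric_of_lt_one (by norm_num) (by norm_num)).mul_left C).mul_left _ |>.mul_right _)
      fun i => ?_
    rw [mul_assoc, hSw, pow_succ', ← mul_assoc]
    calc _ ≤ ‖α'‖ * ‖α' ^ i‖ * ‖(S * w) ^ i‖ * ‖w‖ := by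
          refine (norm_mul_le _ _).trans ?_
          gcongr
          refine (norm_mul_le _ _).trans ?_
          gcongr
          exact norm_mul_le _ _
      _ = ‖α'‖ * (‖(S * w) ^ i‖ * ‖α' ^ i‖) * ‖w‖ := by ring
      _ ≤ _ := mul_le_mul_of_nonneg_right
          (mul_le_mul_of_nonneg_left (hC i) (norm_nonneg _)) (norm_nonneg _)
  obtain ⟨T, hT⟩ := hsum
  refine ⟨T, hT, ?_⟩
  set E := α * α' with hE
  have hE' : α' * α = E := hα.comm.symm
  have Eα' : E * α' = α' := by rw [← hE', hα.outer]
  have αE : α * E = α := by rw [← hE', ← mul_assoc, hα.inner]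
  have S0' : S * α' = 0 := by rw [← Eα', hE, ← mul_assoc, ← mul_assoc, h0]; simp
  have SE : S * E = 0 := by rw [hE, ← mul_assoc, h0, zero_mul]
  have s0 : s * α = 0 := by
    rw [hS.outer, mul_assoc s, hS.comm, ← mul_assoc, mul_assoc (s * s), h0, mul_zero]
  have s0' : s * α' = 0 := by
    rw [hS.outer, mul_assoc s, hS.comm, ← mul_assoc, mul_assoc (s * s), S0', mul_zero]
  have sE : s * E = 0 := by rw [hE, ← mul_assoc, s0, zero_mul]
  have wα : w * α = α := by rw [hw', sub_mul, one_mul, mul_assoc, s0, mul_zero, sub_zero]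
  have wα' : w * α' = α' := by rw [hw', sub_mul, one_mul, mul_assoc, s0', mul_zero, sub_zero]
  have ET : E * T = T := (hT.mul_left E).unique (by
    refine hT.of_eq fun i => ?_
    rw [pow_succ', ← mul_assoc, ← mul_assoc, ← mul_assoc, Eα'])
  have ST : S * T = 0 := (hT.mul_left S).unique (by
    refine hasSum_zero.of_eq fun i => ?_
    rw [pow_succ', ← mul_assoc, ← mul_assoc, ← mul_assoc, S0', zero_mul, zero_mul, zero_mul])
  have Tw : T * w = T := (hT.mul_right w).unique (by
    refine hT.of_eq fun i => ?_
    rw [mul_assoc, ww])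
  have Ts : T * s = 0 := by rw [← Tw, mul_assoc, ws, mul_zero]
  -- Splitting off the term `i = 0` gives a fixed-point equation from which the algebraic identities
  -- for `T` follow.
  have hrec : T = α' * w + α' * T * S := by
    have h1 : HasSum (fun i : ℕ => α' ^ (i + 1 + 1) * S ^ (i + 1) * w) (α' * T * S) := by
      refine HasSum.of_eq ((hT.mul_left α').mul_right S) fun i => ?_
      rw [mul_assoc α', mul_assoc _ w S, ← Sw, pow_succ' α' (i + 1), pow_succ S i]
      noncomm_ring
    have h2 := (hasSum_nat_add_iff' (f := fun i : ℕ => α' ^ (i + 1) * S ^ i * w) 1).2 hT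
    have := h2.unique h1
    simp only [Finset.range_one, Finset.sum_singleton, zero_add, pow_one, pow_zero, mul_one] at this
    rw [← this]; abel
  have αT : α * T = E * w + T * S := by
    conv_lhs => rw [hrec]
    rw [mul_add, ← mul_assoc, ← mul_assoc, ← mul_assoc, ← hE, ET]
  have Tα : T * α = E := by
    rw [hrec, add_mul, mul_assoc, wα, mul_assoc, h0, mul_zero, add_zero, hE']
  have hπ : spectralIdem α α' = 1 - E := rfl
  have MD : (α + S) * ((1 - E) * s + T) = S * s + α * T := by
    have : (α + S) * ((1 - E) * s + T)
      = α * s - α * E * s + α * T + S * s - S * E * s + S * T := by noncomm_ring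
    rw [this, αE, SE, ST]; noncomm_ring
  have DM : ((1 - E) * s + T) * (α + S) = S * s + α * T := by
    have : ((1 - E) * s + T) * (α + S)
      = s * α + s * S - E * (s * α) - E * (s * S) + T * α + T * S := by noncomm_ring
    rw [this, s0, Tα, αT, ← hS.comm, hw']; noncomm_ring
  rw [hπ]
  refine ⟨?_, MD.trans DM.symm, ?_⟩
  · rw [mul_assoc, MD]
    have : ((1 - E) * s + T) * (S * s + α * T)
      = (1 - E) * (s * S * s) + s * α * T - E * (s * α) * T + T * S * s + T * α * T := by
        noncomm_ring
    have TSs : T * S * s = 0 := by rw [mul_assoc, hS.comm, ← mul_assoc, Ts, zero_mul]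
    rw [this, ← hS.outer, s0, TSs, Tα, ET]; noncomm_ring
  · have e : α + S - (α + S) ^ 2 * ((1 - E) * s + T) = (1 - α * T) * (S * w) := by
      have h1 : T * (S * w) = T * S := by rw [Sw, ← mul_assoc, Tw]
      have h2 : α * (E * w + T * S) = α * w + α * (T * S) := by rw [mul_add, ← mul_assoc, αE]
      have h3 : (1 - α * T) * (S * w) = S * w - α * (T * S) := by
        rw [sub_mul, one_mul, mul_assoc, h1]
      rw [pow_two, mul_assoc, MD, h3, αT]
      have : (α + S) * (S * s + (E * w + T * S))
        = α * (S * s) + α * (E * w + T * S) + S * (S * s) + S * E * w + S * T * S := by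
          noncomm_ring
      rw [this, h2, SE, ST, hw']
      noncomm_ring
    rw [e]
    apply PowSmall.gdQuasinilpotent
    have hz : S * w * (1 - α * T) = S * w := by
      rw [mul_sub, mul_one, ← mul_assoc, mul_assoc S, wα, h0, zero_mul, sub_zero]
    have hp : ∀ n, ((1 - α * T) * (S * w)) ^ (n + 1) = (1 - α * T) * (S * w) ^ (n + 1) := by
      intro n
      induction n with
      | zero => simp
      | succ n ih =>
        rw [pow_succ, ih, pow_succ _ (n + 1), pow_succ _ n, mul_assoc, mul_assoc, ← mul_assoc (S * w) (1 - _), hz]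
        noncomm_ring
    refine PowSmall.of_norm_pow_succ_le hq (‖1 - α * T‖ * ‖S * w‖) fun n => ?_
    rw [hp, pow_succ']
    calc _ ≤ ‖1 - α * T‖ * (‖S * w‖ * ‖(S * w) ^ n‖) := by
          refine (norm_mul_le _ _).trans ?_
          gcongr
          exact norm_mul_le _ _
      _ = _ := by ring

/-- A block triangular g-Drazin invertible element whose block in the corner of `1 - P` is
invertible there has a g-Drazin invertible block in the corner of `P`. -/
theorem IsGDrazinInverse.corner {B : Type*} [NormedRing B] [NormedAlgebra ℝ B] [CompleteSpace B]
    {M D P α' : B} (hD : IsGDrazinInverse M D) (hP : P * P = P) (hPM : P * M * (1 - P) = 0)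
    (hM : M * α' = 1 - P) (hα' : (1 - P) * α' = α') :
    IsGDrazinInverse (P * M) (P * D * P) := by
  have hc := hD.comm
  have ho : D * M * D = D := hD.outer.symm
  have hq := hD.quasinilpotent.powSmall
  set q := M - M ^ 2 * D with hqd
  have hPMP : P * M * P = P * M := by
    rw [mul_sub, mul_one, sub_eq_zero] at hPM; exact hPM.symm
  set X := (1 - M * D) * (1 - P) with hX
  have MDMD : (1 - M * D) * (1 - M * D) = 1 - M * D := by
    have : (1 - M * D) * (1 - M * D) = 1 - M * D - M * D + M * (D * M * D) := by noncomm_ring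
    rw [this, ho]; abel
  have hXq : X = q * X * α' := by
    have h1 : q * X * α' = M * ((1 - M * D) * (1 - M * D)) * ((1 - P) * α') := by
      rw [hX, hqd]; noncomm_ring
    have h2 : M * (1 - M * D) = (1 - M * D) * M := by
      rw [mul_sub, sub_mul, mul_one, one_mul, mul_assoc, ← hc]
    rw [h1, MDMD, hα', h2, mul_assoc, hM]
  -- Iterating `X = q * X * α'` bounds `X` by `‖q ^ n‖ * ‖α' ^ n‖ * ‖X‖`, which tends to 0. So the
  -- spectral idempotent of `M` kills `1 - P`, and `D` is block triangular like `M`.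
  have hXn : ∀ n, X = q ^ n * X * α' ^ n := by
    intro n
    induction n with
    | zero => simp
    | succ n ih =>
      calc X = q ^ n * X * α' ^ n := ih
        _ = q ^ n * (q * X * α') * α' ^ n := by rw [← hXq]
        _ = _ := by rw [pow_succ, pow_succ']; noncomm_ring
  have hX0 : X = 0 := by
    obtain ⟨C, hC⟩ := hq.exists_norm_pow_mul_le α' (show (0 : ℝ) < 1 / 2 by norm_num)
    have hlim : Tendsto (fun n : ℕ => C * (1 / 2 : ℝ) ^ n * ‖X‖) atTop (𝓝 0) := by
      simpa using ((tendsto_pow_atTop_nhds_zero_of_lt_one (by norm_num : (0 : ℝ) ≤ 1 / 2)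
        (by norm_num)).const_mul C).mul_const ‖X‖
    refine norm_le_zero_iff.1 (ge_of_tendsto' hlim fun n => ?_)
    calc ‖X‖ = ‖q ^ n * X * α' ^ n‖ := by rw [← hXn]
      _ ≤ ‖q ^ n‖ * ‖X‖ * ‖α' ^ n‖ := by
        refine (norm_mul_le _ _).trans ?_
        gcongr
        exact norm_mul_le _ _
      _ = ‖q ^ n‖ * ‖α' ^ n‖ * ‖X‖ := by ring
      _ ≤ _ := mul_le_mul_of_nonneg_right (hC n) (norm_nonneg _)
  have hDE : D * (1 - P) = α' := by
    have : D * M * (1 - P) = 1 - P := by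
      rw [hX, sub_mul, one_mul, sub_eq_zero, hc] at hX0; exact hX0.symm
    rw [← hM, ← mul_assoc, ← hα', ← mul_assoc, this]
  have PE : P * (1 - P) = 0 := by rw [mul_sub, mul_one, hP, sub_self]
  have hPD : P * D * P = P * D := by
    have : P * D * (1 - P) = 0 := by rw [mul_assoc, hDE, ← hα', ← mul_assoc, PE, zero_mul]
    rw [mul_sub, mul_one, sub_eq_zero] at this; exact this.symm
  have hmul : P * M * (P * D) = P * (M * D) := by rw [← mul_assoc, hPMP, mul_assoc]
  have hmul' : P * D * (P * M) = P * (M * D) := by rw [← mul_assoc, hPD, mul_assoc, hc]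
  rw [hPD]
  refine ⟨?_, hmul.trans hmul'.symm, ?_⟩
  · rw [mul_assoc, hmul, ← mul_assoc, hPD, mul_assoc, ← mul_assoc D, ho]
  · have e : P * M - (P * M) ^ 2 * (P * D) = P * q := by
      rw [pow_two, mul_assoc, hmul, ← mul_assoc, hPMP, hqd]; noncomm_ring
    have hPq : P * q * P = P * q := by
      have : P * q * (1 - P) = 0 := by
        have : P * q * (1 - P) = P * M * (1 - P) - P * M * (M * (D * (1 - P))) := by
          rw [hqd]; noncomm_ring
        rw [this, hDE, hM, hPM, sub_self]
      rw [mul_sub, mul_one, sub_eq_zero] at this; exact this.symm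
    rw [e]
    apply PowSmall.gdQuasinilpotent
    have hp : ∀ n, (P * q) ^ (n + 1) = P * q ^ (n + 1) := by
      intro n
      induction n with
      | zero => simp
      | succ n ih => rw [pow_succ', ih, ← mul_assoc, hPq, mul_assoc, ← pow_succ']
    refine PowSmall.of_norm_pow_succ_le hq (‖P‖ * ‖q‖) fun n => ?_
    rw [hp, pow_succ']
    calc _ ≤ ‖P‖ * (‖q‖ * ‖q ^ n‖) := by
          refine (norm_mul_le _ _).trans ?_
          gcongr
          exact norm_mul_le _ _
      _ = _ := by ring

/-! ### Transfer to matrices, whose operator norm induces the product uniformity. -/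

section

variable {A : Type*} [NormedRing A] [NormedAlgebra ℝ A] [CompleteSpace A]
  {n : Type*} [Fintype n] [DecidableEq n]

attribute [local instance] Matrix.linftyOpNormedRing Matrix.linftyOpNormedAlgebra

theorem Matrix.isGDrazinInverse_cline {x y c : Matrix n n A} (h : IsGDrazinInverse (x * y) c) :
    IsGDrazinInverse (y * x) (y * c ^ 2 * x) :=
  have := Matrix.completeSpace_linftyOp (n := n) (A := A)
  IsGDrazinInverse.cline h

theorem Matrix.gDrazinInvertible_mul_comm {x y : Matrix n n A} :
    GDrazinInvertible (x * y) ↔ GDrazinInvertible (y * x) :=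
  ⟨fun ⟨_, h⟩ => ⟨_, isGDrazinInverse_cline h⟩, fun ⟨_, h⟩ => ⟨_, isGDrazinInverse_cline h⟩⟩

theorem Matrix.isGDrazinInverse_add_of_mul_eq_zero {α α' S s : Matrix n n A}
    (hα : IsGroupInverse α α') (hS : IsGDrazinInverse S s) (h0 : S * α = 0) :
    ∃ T : Matrix n n A,
      HasSum (fun i : ℕ => α' ^ (i + 1) * S ^ i * spectralIdem S s) T ∧
      IsGDrazinInverse (α + S) (spectralIdem α α' * s + T) :=
  have := Matrix.completeSpace_linftyOp (n := n) (A := A)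
  IsGDrazinInverse.add_of_mul_eq_zero hα hS h0

theorem Matrix.isGDrazinInverse_corner {M D P α' : Matrix n n A} (hD : IsGDrazinInverse M D)
    (hP : P * P = P) (hPM : P * M * (1 - P) = 0) (hM : M * α' = 1 - P)
    (hα' : (1 - P) * α' = α') : IsGDrazinInverse (P * M) (P * D * P) :=
  have := Matrix.completeSpace_linftyOp (n := n) (A := A)
  IsGDrazinInverse.corner hD hP hPM hM hα'

end

/-! ### The block matrices of the theorem. -/

theorem theorem2p2 {𝕜 : Type*} [RCLike 𝕜] {A : Type*} [NormedRing A] [NormedAlgebra 𝕜 A]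
    [CompleteSpace A] (a b bd : A)
    (ha : GDrazinInvertible a) (hb : IsGDrazinInverse b bd)
    (hba : GDrazinInvertible (spectralIdem b bd * a))
    (h : spectralIdem b bd * a * bd = 0) :
    List.TFAE
      [GDrazinInvertible !![a, 1; b, 0],
       GDrazinInvertible !![spectralIdem b bd * a, 1; spectralIdem b bd * b, 0],
       GDrazinInvertible !![a * spectralIdem b bd, 1; b * spectralIdem b bd, 0]] ∧
    ∀ Nd : Matrix (Fin 2) (Fin 2) A,
      IsGDrazinInverse !![spectralIdem b bd * a, 1; spectralIdem b bd * b, 0] Nd →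
      let p : A := spectralIdem b bd
      let α : Matrix (Fin 2) (Fin 2) A := !![b * bd * a * b * bd, b * bd; b ^ 2 * bd, 0]
      let α' : Matrix (Fin 2) (Fin 2) A := !![0, bd; b * bd, -(b * bd * a * bd)]
      let S : Matrix (Fin 2) (Fin 2) A := !![b * bd * a * p + p * a, p; b * p, 0]
      let Sd : Matrix (Fin 2) (Fin 2) A :=
        !![b * bd * a + p * a, 1; b, 0] * Nd * !![1, 0; 0, p] * Nd * !![p, 0; 0, p]
      IsGroupInverse α α' ∧
      spectralIdem α α' = !![p, 0; 0, p] ∧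
      IsGDrazinInverse S Sd ∧
      ∃ T : Matrix (Fin 2) (Fin 2) A,
        HasSum (fun i : ℕ => α' ^ (i + 1) * S ^ i * spectralIdem S Sd) T ∧
        IsGDrazinInverse !![a, 1; b, 0] (spectralIdem α α' * Sd + T) := by
  let _ : NormedAlgebra ℝ A := NormedAlgebra.restrictScalars ℝ 𝕜 A
  have ho : bd * b * bd = bd := hb.outer.symm
  have hc : b * bd = bd * b := hb.comm
  obtain ⟨p, hp⟩ : ∃ p, p = spectralIdem b bd := ⟨_, rfl⟩
  rw [← hp] at h
  simp only [← hp]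
  have hpe : p = 1 - b * bd := hp
  have he : 1 - p = b * bd := by rw [hpe, sub_sub_cancel]
  have ebd : b * bd * bd = bd := by rw [hc, ho]
  have bde : bd * (b * bd) = bd := by rw [← mul_assoc, ho]
  have pbd : p * bd = 0 := by rw [hpe, sub_mul, one_mul, ebd, sub_self]
  have pb : p * b = b * p := by
    rw [hpe, sub_mul, mul_sub, one_mul, mul_one, mul_assoc, ← hc]
  have pe : p * (b * bd) = 0 := by rw [← mul_assoc, pb, mul_assoc, pbd, mul_zero]
  have pp : p * p = p := by
    nth_rw 2 [hpe]
    rw [mul_sub, mul_one, pe, sub_zero]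
  have pbp : p * (b * p) = b * p := by rw [← mul_assoc, pb, mul_assoc, pp]
  have pap : p * a * p = p * a := by
    nth_rw 2 [hpe]
    rw [mul_sub, mul_one, hc, ← mul_assoc, h, zero_mul, sub_zero]
  have ee : b * bd * (b * bd) = b * bd := by rw [mul_assoc, bde]
  have ebe : b * bd * b * bd = b * bd := by rw [mul_assoc, ee]
  have b2 : b ^ 2 * bd = b * bd * b := by rw [pow_two, mul_assoc, hc, ← mul_assoc, hc]
  have b3 : bd * (b ^ 2 * bd) = b * bd := by rw [b2, ← mul_assoc, bde, hc]
  have b4 : b ^ 2 * bd * bd = b * bd := by rw [b2, mul_assoc, ee]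
  have abd : a * bd = b * bd * a * bd := by
    rwa [hpe, sub_mul, sub_mul, one_mul, sub_eq_zero] at h
  have ea : b * bd * a + p * a = a := by rw [← add_mul, ← he, sub_add_cancel, one_mul]
  have eap : b * bd * a * p + p * a = a * p := by rw [← pap, ← add_mul, ea]
  set M : Matrix (Fin 2) (Fin 2) A := !![a, 1; b, 0] with hM
  set N : Matrix (Fin 2) (Fin 2) A := !![p * a, 1; p * b, 0] with hN
  set K : Matrix (Fin 2) (Fin 2) A := !![a * p, 1; b * p, 0] with hK
  set P : Matrix (Fin 2) (Fin 2) A := !![p, 0; 0, p] with hP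
  set Q : Matrix (Fin 2) (Fin 2) A := !![1, 0; 0, p] with hQ
  set α : Matrix (Fin 2) (Fin 2) A := !![b * bd * a * b * bd, b * bd; b ^ 2 * bd, 0] with hα
  set α' : Matrix (Fin 2) (Fin 2) A := !![0, bd; b * bd, -(b * bd * a * bd)] with hα'
  set S : Matrix (Fin 2) (Fin 2) A := !![b * bd * a * p + p * a, p; b * p, 0] with hS
  have hMP : M * P = S := by
    rw [hM, hP, hS, Matrix.mul_fin_two, eap]; simp
  have hPM : P * M = N * Q := by
    rw [hM, hP, hN, hQ, Matrix.mul_fin_two, Matrix.mul_fin_two]; simp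
  have hQN : Q * N = N := by
    rw [hN, hQ, Matrix.mul_fin_two, ← mul_assoc p p, pp]; simp
  have hKQ : K * Q = S := by
    rw [hK, hQ, hS, Matrix.mul_fin_two, eap]; simp
  have hQK : Q * K = K := by
    rw [hK, hQ, Matrix.mul_fin_two, pbp]; simp
  have hPP : P * P = P := by
    rw [hP, Matrix.mul_fin_two, pp]; simp
  have hQP : Q * P = P := by
    rw [hQ, hP, Matrix.mul_fin_two, pp]; simp
  have h1P : 1 - P = !![b * bd, 0; 0, b * bd] := by
    rw [hP, Matrix.one_fin_two, ← he]
    ext i j; fin_cases i <;> fin_cases j <;> simp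
  -- Here the hypothesis enters, in the form `p * a * p = p * a`.
  have hPMP : P * M * (1 - P) = 0 := by
    rw [mul_sub, mul_one, mul_assoc, hMP, hM, hP, hS, Matrix.mul_fin_two, Matrix.mul_fin_two, eap,
      ← mul_assoc, pap]
    ext i j; fin_cases i <;> fin_cases j <;> simp [pp, pbp, pb]
  have hEα : (1 - P) * α = α := by
    have e1 : b * bd * (b * bd * a * b * bd) = b * bd * a * b * bd := by
      simp only [← mul_assoc, ebe]
    have e2 : b * bd * (b ^ 2 * bd) = b ^ 2 * bd := by rw [b2, ← mul_assoc, ee]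
    rw [h1P, hα, Matrix.mul_fin_two, e1, e2, ee]
    simp
  have e3 : b * bd * (b * bd * a * bd) = b * bd * a * bd := by simp only [← mul_assoc, ebe]
  have hEα' : (1 - P) * α' = α' := by
    rw [h1P, hα', Matrix.mul_fin_two, ebd, ee, mul_neg, mul_neg, e3]
    simp
  have hMα' : M * α' = 1 - P := by
    rw [h1P, hα', hM, Matrix.mul_fin_two, ← abd]
    simp
  have hαα' : α * α' = 1 - P := by
    have e4 : b * bd * a * b * bd * bd = b * bd * a * bd := by
      rw [mul_assoc _ b, mul_assoc _ (b * bd), ebd]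
    rw [h1P, hα', hα, Matrix.mul_fin_two, mul_neg, e3, e4, ee, b4]
    simp
  have hα'α : α' * α = 1 - P := by
    have e4 : b * bd * (b * bd * a * b * bd) = b * bd * a * b * bd := by
      simp only [← mul_assoc, ebe]
    have e5 : b * bd * a * bd * (b ^ 2 * bd) = b * bd * a * b * bd := by
      rw [mul_assoc, b3, ← mul_assoc]
    rw [h1P, hα', hα, Matrix.mul_fin_two, neg_mul, e4, e5, ee, b3]
    simp
  have hPα : P * α = 0 := by
    rw [← hEα, ← mul_assoc, mul_sub, hPP, mul_one, sub_self, zero_mul]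
  have hSα : S * α = 0 := by rw [← hMP, mul_assoc, hPα, mul_zero]
  have hαS : α + S = M := by
    have e4 : b * bd * a * b * bd + a * p = a := by
      rw [mul_assoc _ b, ← eap, ← add_assoc, ← mul_add, ← he, sub_add_cancel, mul_one, he, ea]
    have e5 : b ^ 2 * bd + b * p = b := by
      rw [pow_two, mul_assoc, ← mul_add, ← he, sub_add_cancel, mul_one]
    have e6 : b * bd + p = 1 := by rw [← he, sub_add_cancel]
    rw [hα, hS, hM, eap]
    ext i j; fin_cases i <;> fin_cases j <;> simp [e4, e5, e6]
  have hgrp : IsGroupInverse α α' :=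
    ⟨by rw [hαα', hEα], by rw [hα'α, hEα'], hαα'.trans hα'α.symm⟩
  have hαπ : spectralIdem α α' = P := by rw [spectralIdem, hαα', sub_sub_cancel]
  have hSN : GDrazinInvertible S ↔ GDrazinInvertible N := by
    rw [← hMP, Matrix.gDrazinInvertible_mul_comm, hPM, Matrix.gDrazinInvertible_mul_comm, hQN]
  have hSK : GDrazinInvertible S ↔ GDrazinInvertible K := by
    rw [← hKQ, Matrix.gDrazinInvertible_mul_comm, hQK]
  have hSM : GDrazinInvertible S ↔ GDrazinInvertible M := by
    refine ⟨fun ⟨s, hs⟩ => ?_, fun ⟨D, hD⟩ => ?_⟩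
    · obtain ⟨T, -, hT⟩ := Matrix.isGDrazinInverse_add_of_mul_eq_zero hgrp hs hSα
      rw [hαS] at hT
      exact ⟨_, hT⟩
    · rw [← hMP, Matrix.gDrazinInvertible_mul_comm]
      exact ⟨_, Matrix.isGDrazinInverse_corner hD hPP hPMP hMα' hEα'⟩
  refine ⟨?_, fun Nd hNd => ?_⟩
  · tfae_have 1 ↔ 2 := hSM.symm.trans hSN
    tfae_have 1 ↔ 3 := hSM.symm.trans hSK
    tfae_finish
  · simp only [ea, ← hM]
    -- Cline's formula twice: from `N = Q * N` to `N * Q = P * M`, with inverse `Nd * Q`, then to `M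
    -- * P = S`.
    have hSd : IsGDrazinInverse S (M * Nd * Q * Nd * P) := by
      have h1 : IsGDrazinInverse (N * Q) (N * Nd ^ 2 * Q) :=
        Matrix.isGDrazinInverse_cline (by rw [hQN]; exact hNd)
      rw [← hPM] at h1
      have h2 := Matrix.isGDrazinInverse_cline h1
      have h3 : N * Nd ^ 2 = Nd := by
        rw [pow_two, ← mul_assoc, hNd.comm, ← hNd.outer]
      rw [hMP, h3] at h2
      have h4 : M * (Nd * Q) ^ 2 * P = M * Nd * Q * Nd * P := by
        rw [pow_two]
        simp only [mul_assoc, hQP]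
      rwa [h4] at h2
    obtain ⟨T, hT, hD⟩ := Matrix.isGDrazinInverse_add_of_mul_eq_zero hgrp hSd hSα
    rw [hαS] at hD
    exact ⟨hgrp, hαπ, hSd, T, hT, hD⟩
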